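/- A metric space $M$ is \emph{geodesic} if any two points $x,y\in M$ are joined by an isometric copy of the interval $[0,d(x,y)]$, and \emph{uniformly discrete} if there is $\delta>0$ with $d(x,y)\ge\delta$ for all $x\ne y$. Metric spaces $N$ and $M$ are \emph{quasi-isometric} if there are a map $\alpha:N\to M$ and constants $C_1\ge 1$, $C_2,D\ge 0$ such that $\frac1{C_1}d(x_1,x_2)-C_2\le d(\alpha(x_1),\alpha(x_2))\le C_1d(x_1,x_2)+C_2$ for all $x_1,x_2\in N$ and every point of $M$ is at distance at most $D$ from a point of $\alpha(N)$. Let $T$ be a total order on a metric space $M$ with at least two points. For a finite set $X\subset M$ with points $x_1<_T\dots<_Tx_k$ put $l_T(X)=\sum_{i=1}^{k-1}d(x_i,x_{i+1})$, and let $l_{\mathrm{opt}}(X)$ be the minimal length of a path (a finite sequence of points, with length the sum of the consecutive distances) that visits all points of $X$. For $k\ge1$ let $$\operatorname{OR}_{M,T}(k)=\sup_{X\subset M,\ 2\le\#X\le k+1}\frac{l_T(X)}{l_{\mathrm{opt}}(X)}.$$ The \emph{order breakpoint} $\operatorname{Br}(M,T)$ is the smallest integer $s\ge1$ with $\operatorname{OR}_{M,T}(s)<s$,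 or $\infty$ if there is no such $s$, and $\operatorname{Br}(M)=\min_T\operatorname{Br}(M,T)$ over all total orders $T$ on $M$. For a one-point space, $\operatorname{Br}(M)=1$. \textbf{Lemma.} Let $M$ be a non-empty metric space that is quasi-isometric to a geodesic metric space. (1) If $M$ is not quasi-isometric to a point, to the ray $[0,\infty)$ or to the line $\mathbb R$, then $\operatorname{Br}(M)\ge3$. (2) If $M$ is uniformly discrete, then $\operatorname{Br}(M)\le2$ if and only if $M$ is bounded or quasi-isometric to the ray $[0,\infty)$ or to the line $\mathbb R$. (3) If $M$ has at least two points, then $\operatorname{Br}(M)\le2$ means $\operatorname{Br}(M)=2$. -/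

import Mathlib

open scoped NNReal

namespace OrderRatio

/-- `α` is a quasi-isometric imbedding with constants `C₁ ≥ 1` and `C₂ ≥ 0`. -/
def IsQuasiIsometricImbedding {N M : Type*} [MetricSpace N] [MetricSpace M]
    (α : N → M) (C₁ C₂ : ℝ) : Prop :=
  1 ≤ C₁ ∧ 0 ≤ C₂ ∧ ∀ x₁ x₂ : N,
    1 / C₁ * dist x₁ x₂ - C₂ ≤ dist (α x₁) (α x₂) ∧
      dist (α x₁) (α x₂) ≤ C₁ * dist x₁ x₂ + C₂

/-- `α` is a quasi-isometry: a quasi-isometric imbedding whose target is at bounded distance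
from its image. -/
def IsQuasiIsometry {N M : Type*} [MetricSpace N] [MetricSpace M] (α : N → M) : Prop :=
  (∃ C₁ C₂ : ℝ, IsQuasiIsometricImbedding α C₁ C₂) ∧
    ∃ D : ℝ, ∀ y : M, ∃ x : N, dist y (α x) ≤ D

/-- The spaces `N` and `M` are quasi-isometric. -/
def QuasiIsometric (N M : Type*) [MetricSpace N] [MetricSpace M] : Prop :=
  ∃ α : N → M, IsQuasiIsometry α

/-- Any two points are joined by a geodesic segment, that is, by an isometric copy of the
interval `[0, dist x y]`. -/
def IsGeodesicSpace (M : Type*) [MetricSpace M] : Prop :=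
  ∀ x y : M, ∃ γ : ℝ → M, γ 0 = x ∧ γ (dist x y) = y ∧
    ∀ s ∈ Set.Icc 0 (dist x y), ∀ t ∈ Set.Icc 0 (dist x y), dist (γ s) (γ t) = |s - t|

/-- Distances between distinct points are bounded away from zero. -/
def UniformlyDiscrete (M : Type*) [MetricSpace M] : Prop :=
  ∃ δ : ℝ, 0 < δ ∧ ∀ x y : M, x ≠ y → δ ≤ dist x y

/-- The length `d(x₁, x₂) + d(x₂, x₃) + ⋯` of the path through the given points, in order. -/
noncomputable def pathLength {M : Type*} [MetricSpace M] : List M → ℝ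
  | [] => 0
  | [_] => 0
  | x :: y :: l => dist x y + pathLength (y :: l)

/-- `l_T(X)`: the length of the path that visits the points of `X` in the increasing order `T`. -/
noncomputable def orderLength {M : Type*} [MetricSpace M] (T : LinearOrder M) (X : Finset M) : ℝ :=
  pathLength (X.sort (fun a b => a ≤ b))

/-- `l_opt(X)`: the minimal length of a path (a finite sequence of points of `M`) that visits all
points of `X`. -/
noncomputable def optLength {M : Type*} [MetricSpace M] (X : Finset M) : ℝ :=
  sInf {r : ℝ | ∃ l : List M, (∀ x ∈ X, x ∈ l) ∧ r = pathLength l}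

open scoped Classical in
/-- The order ratio function `OR_{M,T}(k)`: the supremum of `l_T(X) / l_opt(X)` over the finite
subsets `X` with `2 ≤ #X ≤ k + 1`. By convention it is `1` if `M` has at most one point.
The supremum is taken in the extended reals. -/
noncomputable def orderRatio {M : Type*} [MetricSpace M] (T : LinearOrder M) (k : ℕ) : EReal :=
  if Subsingleton M then 1
  else ⨆ (X : Finset M) (_ : 2 ≤ X.card ∧ X.card ≤ k + 1),
    ((orderLength T X / optLength X : ℝ) : EReal)

open scoped Classical in
/-- The order breakpoint `Br(M,T)`: the smallest integer `s ≥ 1` such that `OR_{M,T}(s) < s`,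
and `∞` if there is none. By convention it is `1` if `M` has at most one point. -/
noncomputable def orderBreakpointOf {M : Type*} [MetricSpace M] (T : LinearOrder M) : ℕ∞ :=
  if Subsingleton M then 1
  else ⨅ (s : ℕ) (_ : 1 ≤ s ∧ orderRatio T s < (s : EReal)), (s : ℕ∞)

/-- The order breakpoint `Br(M)`: the minimum of `Br(M,T)` over all total orders `T` on `M`. -/
noncomputable def orderBreakpoint (M : Type*) [MetricSpace M] : ℕ∞ :=
  ⨅ T : LinearOrder M, orderBreakpointOf T

/-- `M` is quasi-isometric to the ray `[0, ∞)`. -/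
def QuasiIsometricToRay (M : Type*) [MetricSpace M] : Prop := QuasiIsometric M ℝ≥0

/-- `M` is quasi-isometric to the line. -/
def QuasiIsometricToLine (M : Type*) [MetricSpace M] : Prop := QuasiIsometric M ℝ

/-- `M` is quasi-isometric to a point. -/
def QuasiIsometricToPoint (M : Type*) [MetricSpace M] : Prop := QuasiIsometric M PUnit.{1}

end OrderRatio

/-! On a space with at least two points, `OR(1) ≥ 1`, so `Br(M) ≤ 2` says that some order has `OR(2)
< 2`. Only triples matter: this holds iff, for some `K`, `x < y < z` forces `d(x,y) ≤ K d(x,z)`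
(`orderBreakpoint_le_two_iff`).

Given such an order, a geodesic from the image of `x` to that of `z` must leave the initial segment
`{w ≤ y}` somewhere, and the inequality traps `y` near the crossing. Distances are therefore
additive along the order up to a constant (`exists_coarse_additivity`), and signed distance to a
base point maps `M` to `ℝ` with bounded error and no large gaps. Whether the image is bounded on
both sides, one side or neither gives point, ray or line (`point_or_ray_or_line`).

Conversely, pulling the order of `ℝ` back along a quasi-isometric imbedding gives the inequality up
to an additive error, which uniform discreteness absorbs into `K` (`exists_order_of_imbedding`). -/

namespace OrderRatio

/-! ### Lower bounds for path lengths -/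

section Paths

variable {M : Type*} [MetricSpace M]

theorem pathLength_nonneg (l : List M) : 0 ≤ pathLength l := by
  induction l with
  | nil => simp [pathLength]
  | cons a t ih =>
    cases t with
    | nil => simp [pathLength]
    | cons b t => simp only [pathLength]; positivity

theorem pathLength_le_cons (a : M) (l : List M) : pathLength l ≤ pathLength (a :: l) := by
  cases l with
  | nil => simp [pathLength]
  | cons b t => simp [pathLength]

theorem dist_head_le_pathLength {x : M} (t : List M) :
    ∀ a : M, x ∈ a :: t → dist a x ≤ pathLength (a :: t) := by
  induction t with
  | nil => intro a hx; simp at hx; simp [pathLength, hx]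
  | cons b t ih =>
    intro a hx
    rcases List.mem_cons.1 hx with rfl | hx
    · simpa using pathLength_nonneg _
    · have := ih b hx
      simp only [pathLength]
      linarith [dist_triangle a b x]

theorem dist_le_pathLength {x y : M} (l : List M) (hx : x ∈ l) (hy : y ∈ l) :
    dist x y ≤ pathLength l := by
  induction l with
  | nil => simp at hx
  | cons a t ih =>
    by_cases hxa : x = a
    · subst hxa; exact dist_head_le_pathLength t x hy
    by_cases hya : y = a
    · subst hya; rw [dist_comm]; exact dist_head_le_pathLength t y hx
    exact (ih (by simpa [hxa] using hx) (by simpa [hya] using hy)).trans (pathLength_le_cons a t)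

/-- A path starting at `a` first reaches one of `y`, `z`, then still has to travel to the other. -/
theorem min_dist_head_add_le_pathLength {y z : M} (t : List M) :
    ∀ a : M, y ∈ a :: t → z ∈ a :: t →
      min (dist a y) (dist a z) + dist y z ≤ pathLength (a :: t) := by
  induction t with
  | nil => intro a hy hz; simp at hy hz; simp [pathLength, hy, hz]
  | cons b t ih =>
    intro a hy hz
    by_cases hya : y = a
    · subst hya
      simpa using dist_head_le_pathLength _ y hz
    by_cases hza : z = a
    · subst hza
      simpa [dist_comm y z] using dist_head_le_pathLength _ z hy
    have := ih b (by simpa [hya] using hy) (by simpa [hza] using hz)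
    simp only [pathLength]
    have h1 := dist_triangle a b y
    have h2 := dist_triangle a b z
    have : min (dist a y) (dist a z) ≤ dist a b + min (dist b y) (dist b z) := by
      rw [← min_add_add_left]; exact min_le_min h1 h2
    linarith

/-- The two terms correspond to visiting `y` between `x` and `z`, or not. Discarding the start of
the path up to the first of the three points reduces to the previous bound. -/
theorem three_points_le_pathLength {x y z : M} (l : List M) (hx : x ∈ l) (hy : y ∈ l)
    (hz : z ∈ l) :
    min (dist x y + dist y z) (dist x z + min (dist x y) (dist y z)) ≤ pathLength l := by
  induction l with
  | nil => simp at hx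
  | cons a t ih =>
    by_cases hxa : x = a
    · subst hxa
      have := min_dist_head_add_le_pathLength t x hy hz
      grind
    by_cases hya : y = a
    · subst hya
      have := min_dist_head_add_le_pathLength t y hx hz
      grind [dist_comm x y]
    by_cases hza : z = a
    · subst hza
      have := min_dist_head_add_le_pathLength t z hx hy
      grind [dist_comm x z, dist_comm y z]
    exact (ih (by simpa [hxa] using hx) (by simpa [hya] using hy)
      (by simpa [hza] using hz)).trans (pathLength_le_cons a t)

theorem optLength_le (X : Finset M) (l : List M) (h : ∀ x ∈ X, x ∈ l) :
    optLength X ≤ pathLength l :=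
  csInf_le ⟨0, by rintro _ ⟨l, -, rfl⟩; exact pathLength_nonneg l⟩ ⟨l, h, rfl⟩

theorem le_optLength (X : Finset M) (c : ℝ)
    (h : ∀ l : List M, (∀ x ∈ X, x ∈ l) → c ≤ pathLength l) : c ≤ optLength X :=
  le_csInf ⟨_, X.toList, by simp, rfl⟩ (by rintro _ ⟨l, hl, rfl⟩; exact h l hl)

open scoped Classical in
theorem orderLength_toFinset (T : LinearOrder M) (l : List M) (h : l.Pairwise (T.lt)) :
    orderLength T l.toFinset = pathLength l := by
  let := T
  unfold orderLength
  congr 1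
  refine (List.toFinset_sort _ (h.imp fun hab => ne_of_lt hab)).2 ?_
  exact h.imp fun hab => le_of_lt hab

theorem exists_list_of_card (T : LinearOrder M) (X : Finset M) :
    ∃ l : List M, l.Pairwise T.lt ∧ l.length = X.card ∧ (∀ x, x ∈ l ↔ x ∈ X) ∧
      orderLength T X = pathLength l := by
  let := T
  exact ⟨X.sort (fun a b => a ≤ b), Finset.sortedLT_sort X |>.pairwise, by simp, by simp, rfl⟩

end Paths

/-! ### Breakpoint at most two as a condition on triples -/

section Ratio

variable {M : Type*} [MetricSpace M]

theorem one_le_orderRatio [Nontrivial M] (T : LinearOrder M) {k : ℕ} (hk : 1 ≤ k) :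
    1 ≤ orderRatio T k := by
  classical
  let := T
  obtain ⟨x, y, hxy⟩ : ∃ x y : M, x < y := by
    obtain ⟨x, y, h⟩ := exists_pair_ne M
    rcases lt_or_gt_of_ne h with h | h
    exacts [⟨x, y, h⟩, ⟨y, x, h⟩]
  rw [orderRatio, if_neg (not_subsingleton M)]
  have hlen : orderLength T [x, y].toFinset = dist x y := by
    rw [orderLength_toFinset T _ (by simpa using hxy)]; simp [pathLength]
  have hopt : optLength [x, y].toFinset = dist x y := by
    apply le_antisymm
    · refine (optLength_le _ [x, y] (by simp)).trans ?_
      simp [pathLength]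
    · exact le_optLength _ _ fun l hl => dist_le_pathLength l (hl x (by simp)) (hl y (by simp))
  have hcard : [x, y].toFinset.card = 2 := by
    simp [Finset.card_pair hxy.ne]
  refine le_trans ?_ (le_iSup₂ (f := fun (X : Finset M) (_ : 2 ≤ X.card ∧ X.card ≤ k + 1) =>
    ((orderLength T X / optLength X : ℝ) : EReal)) [x, y].toFinset ⟨hcard.ge, by omega⟩)
  rw [hlen, hopt, div_self (dist_pos.2 hxy.ne).ne']
  rfl

theorem exists_between_bound_of_orderRatio_lt [Nontrivial M] (T : LinearOrder M)
    (h : orderRatio T 2 < 2) :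
    ∃ K : ℝ, 0 ≤ K ∧ ∀ x y z : M, T.lt x y → T.lt y z → dist x y ≤ K * dist x z := by
  classical
  rw [orderRatio, if_neg (not_subsingleton M)] at h
  obtain ⟨s, hs, hs2⟩ := EReal.lt_iff_exists_real_btwn.1 h
  have hs2 : s < 2 := EReal.coe_lt_coe_iff.1 hs2
  -- With `a = d(x,y)`, `b = d(y,z)`, `c = d(x,z)`, the competing path `y, x, z` gives `a + b ≤ s(a
  -- + c)`; since `b ≥ a - c`, this yields `(2 - s)a ≤ (1 + s)c`.
  have key : ∀ x y z : M, T.lt x y → T.lt y z → dist x y ≤ (1 + |s|) / (2 - s) * dist x z := by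
    intro x y z hxy hyz
    let := T
    have hxz : x < z := lt_trans hxy hyz
    have hcard : [x, y, z].toFinset.card = 3 := by
      rw [List.toFinset_card_of_nodup]
      · rfl
      · have h1 : x ≠ y := ne_of_lt hxy
        have h2 : y ≠ z := ne_of_lt hyz
        simp [h1, h2, hxz.ne]
    have hlen : orderLength T [x, y, z].toFinset = dist x y + dist y z := by
      rw [orderLength_toFinset T _ (by simpa using ⟨⟨hxy, hxz⟩, hyz⟩)]; simp [pathLength]
    have hopt : optLength [x, y, z].toFinset ≤ dist x y + dist x z := by
      refine (optLength_le _ [y, x, z] (by simp)).trans ?_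
      simp [pathLength, dist_comm]
    have hpos : 0 < optLength [x, y, z].toFinset :=
      (dist_pos.2 hxz.ne).trans_le
        (le_optLength _ _ fun l hl => dist_le_pathLength l (hl x (by simp)) (hl z (by simp)))
    have := (le_iSup₂ (f := fun (X : Finset M) (_ : 2 ≤ X.card ∧ X.card ≤ 2 + 1) =>
      ((orderLength T X / optLength X : ℝ) : EReal)) [x, y, z].toFinset
        ⟨by omega, by omega⟩).trans hs.le
    have := EReal.coe_le_coe_iff.1 this
    rw [div_le_iff₀ hpos, hlen] at this
    have h2s : 0 < 2 - s := by linarith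
    rw [div_mul_eq_mul_div, le_div_iff₀ h2s]
    have htri : dist x y ≤ dist x z + dist y z := by
      simpa [dist_comm] using dist_triangle x z y
    have hs0 : 0 ≤ s := by
      by_contra hneg
      have := mul_neg_of_neg_of_pos (not_le.1 hneg) hpos
      linarith [dist_nonneg (x := x) (y := y), dist_nonneg (x := y) (y := z)]
    rw [abs_of_nonneg hs0]
    nlinarith [mul_le_mul_of_nonneg_left hopt hs0]
  exact ⟨_, div_nonneg (by positivity) (by linarith), key⟩

theorem orderRatio_lt_two [Nontrivial M] (T : LinearOrder M) {K : ℝ} (hK : 0 ≤ K)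
    (h : ∀ x y z : M, T.lt x y → T.lt y z → dist x y ≤ K * dist x z) :
    orderRatio T 2 < 2 := by
  let := T
  rw [orderRatio, if_neg (not_subsingleton M)]
  -- For a path of length `a + c` the triangle inequality gives `a + b ≤ 2(a + c) - c`, and `a ≤ Kc`
  -- makes `c` at least the fraction `1 / (K + 2)` of `a + c`.
  have hlt : ((2 - 1 / (K + 2) : ℝ) : EReal) < 2 := by
    have : (2 - 1 / (K + 2) : ℝ) < 2 := by
      have : 0 < 1 / (K + 2) := by positivity
      linarith
    exact EReal.coe_lt_coe_iff.2 this
  have hK2 : 1 / (K + 2) ≤ 1 := by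
    rw [div_le_one (by positivity)]; linarith
  have hone : 1 / (K + 2) * (K + 2) = 1 := by field_simp
  have hpos : 0 < 1 / (K + 2) := by positivity
  set u := 1 / (K + 2)
  refine lt_of_le_of_lt (iSup₂_le fun X hX => ?_) hlt
  rw [EReal.coe_le_coe_iff]
  obtain ⟨l, hl, hcard, hmem, hlen⟩ := exists_list_of_card T X
  rw [hlen]
  have hopt0 : 0 ≤ optLength X := le_optLength _ _ fun l _ => pathLength_nonneg l
  refine div_le_of_le_mul₀ hopt0 (by linarith) ?_
  match l, hl, hcard, hmem with
  | [], _, hcard, _ => simp at hcard; omega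
  | [x], _, hcard, _ => simp at hcard; omega
  | [x, y], _, _, hmem =>
    have : dist x y ≤ optLength X := le_optLength _ _ fun l hl =>
      dist_le_pathLength l (hl x ((hmem x).1 (by simp))) (hl y ((hmem y).1 (by simp)))
    simp only [pathLength]
    nlinarith
  | [x, y, z], hl, _, hmem =>
    have hle := le_optLength X _ fun l hl => three_points_le_pathLength l
      (hl x ((hmem x).1 (by simp))) (hl y ((hmem y).1 (by simp))) (hl z ((hmem z).1 (by simp)))
    simp only [List.pairwise_cons, List.mem_cons] at hl
    have hxy := h x y z (hl.1 y (by simp)) (hl.2.1 z (by simp))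
    have h1 : dist y z ≤ dist x y + dist x z := by
      simpa [dist_comm] using dist_triangle y x z
    have h2 : dist x y ≤ dist x z + dist y z := by
      simpa [dist_comm] using dist_triangle x z y
    have hx0 := dist_nonneg (x := x) (y := y)
    have hy0 := dist_nonneg (x := y) (y := z)
    have hz0 := dist_nonneg (x := x) (y := z)
    simp only [pathLength, add_zero]
    refine le_trans ?_ (mul_le_mul_of_nonneg_left hle (by linarith))
    have hc : u * (dist x y + dist x z) ≤ dist x z := by
      have : dist x y + dist x z ≤ (K + 2) * dist x z := by linarith
      nlinarith [mul_le_mul_of_nonneg_left this hpos.le]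
    rcases min_cases (dist x y + dist y z) (dist x z + min (dist x y) (dist y z)) with
      ⟨e, -⟩ | ⟨e, -⟩
    · rw [e]; nlinarith
    · rw [e]
      rcases min_cases (dist x y) (dist y z) with ⟨e, he⟩ | ⟨e, he⟩
      · rw [e]; nlinarith
      · rw [e]; nlinarith [mul_le_mul_of_nonneg_left he.le hpos.le]
  | _ :: _ :: _ :: _ :: _, _, hcard, _ => simp at hcard; omega

theorem two_le_orderBreakpointOf [Nontrivial M] (T : LinearOrder M) :
    2 ≤ orderBreakpointOf T := by
  rw [orderBreakpointOf, if_neg (not_subsingleton M)]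
  refine le_iInf₂ fun s hs => ?_
  have hs1 : s ≠ 1 := by
    rintro rfl
    exact absurd hs.2 (not_lt.2 (by simpa using one_le_orderRatio T le_rfl))
  have : 2 ≤ s := by omega
  exact_mod_cast this

theorem orderBreakpointOf_le_two_iff [Nontrivial M] (T : LinearOrder M) :
    orderBreakpointOf T ≤ 2 ↔ orderRatio T 2 < 2 := by
  rw [orderBreakpointOf, if_neg (not_subsingleton M)]
  constructor
  · intro h
    have h3 : (2 : ℕ∞) < 3 := by norm_num
    obtain ⟨s, hs⟩ := iInf_lt_iff.1 (h.trans_lt h3)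
    obtain ⟨hs, hs3⟩ := iInf_lt_iff.1 hs
    have hs3 : s < 3 := by exact_mod_cast hs3
    obtain rfl | rfl : s = 1 ∨ s = 2 := by omega
    · exact absurd hs.2 (not_lt.2 (by simpa using one_le_orderRatio T le_rfl))
    · exact_mod_cast hs.2
  · intro h
    exact iInf₂_le (f := fun (s : ℕ) (_ : 1 ≤ s ∧ orderRatio T s < (s : EReal)) => (s : ℕ∞)) 2
      ⟨by norm_num, by exact_mod_cast h⟩

theorem two_le_orderBreakpoint [Nontrivial M] : 2 ≤ orderBreakpoint M :=
  le_iInf fun T => two_le_orderBreakpointOf T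

theorem orderBreakpoint_le_two_iff [Nontrivial M] :
    orderBreakpoint M ≤ 2 ↔ ∃ T : LinearOrder M, ∃ K : ℝ, 0 ≤ K ∧
      ∀ x y z : M, T.lt x y → T.lt y z → dist x y ≤ K * dist x z := by
  constructor
  · intro h
    have h3 : (2 : ℕ∞) < 3 := by norm_num
    obtain ⟨T, hT⟩ := iInf_lt_iff.1 (h.trans_lt h3)
    have hT : orderBreakpointOf T ≤ 2 := Order.le_of_lt_add_one hT
    exact ⟨T, exists_between_bound_of_orderRatio_lt T ((orderBreakpointOf_le_two_iff T).1 hT)⟩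
  · rintro ⟨T, K, hK, h⟩
    exact (iInf_le _ T).trans ((orderBreakpointOf_le_two_iff T).2 (orderRatio_lt_two T hK h))

end Ratio

/-! ### Coarse geometry and the classification -/

section Coarse

variable {M N : Type*} [MetricSpace M] [MetricSpace N]

/-- Along a coarse geodesic from a point satisfying `P` to a point not satisfying it, there are
nearby points where `P` changes. -/
theorem exists_crossing {M : Type*} (hN : IsGeodesicSpace N) {α : M → N} {D : ℝ}
    (hD : ∀ y : N, ∃ x : M, dist y (α x) ≤ D) (P : M → Prop) {x y : M} (hx : P x) (hy : ¬ P y) :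
    ∃ p q : M, P p ∧ ¬ P q ∧ dist (α p) (α q) ≤ 2 * D + 1 ∧
      dist (α x) (α p) + dist (α p) (α y) ≤ dist (α x) (α y) + 2 * D := by
  classical
  obtain ⟨γ, h0, h1, hγ⟩ := hN (α x) (α y)
  choose g hg using hD
  have hD0 : 0 ≤ D := dist_nonneg.trans (hg (α x))
  set L := dist (α x) (α y) with hL
  have hL0 : 0 ≤ L := dist_nonneg
  let s : ℕ → ℝ := fun i => min (i : ℝ) L
  -- The geodesic is sampled at integer times; the ends are exactly `x` and `y`, where `P` is known.
  let q : ℕ → M := fun i => if i = 0 then x else if L ≤ i then y else g (γ (s i))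
  have hs : ∀ i, s i ∈ Set.Icc 0 L := fun i => ⟨le_min (Nat.cast_nonneg i) hL0, min_le_right _ _⟩
  have hq : ∀ i, dist (γ (s i)) (α (q i)) ≤ D := by
    intro i
    by_cases hi : i = 0
    · subst hi
      simpa [q, s, hL0, h0] using hD0
    by_cases hi' : L ≤ i
    · simpa [q, s, hi, hi', h1] using hD0
    · simpa [q, hi, hi'] using hg _
  have hex : ∃ i, ¬ P (q i) := by
    obtain ⟨n, hn⟩ := exists_nat_ge L
    -- Index `0` always gives `x`, even when `L = 0`, so a positive index is needed.
    refine ⟨n + 1, ?_⟩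
    have : L ≤ (n : ℝ) + 1 := by linarith
    simpa [q, this] using hy
  obtain ⟨i, hi, hi'⟩ : ∃ i, P (q i) ∧ ¬ P (q (i + 1)) := by
    by_contra hcon
    push Not at hcon
    obtain ⟨n, hn⟩ := hex
    refine hn ?_
    clear hn
    induction n with
    | zero => simpa [q] using hx
    | succ n ih => exact hcon n ih
  have hstep : |s i - s (i + 1)| ≤ 1 := by
    have := abs_min_sub_min_le_max (i : ℝ) L ((i + 1 : ℕ) : ℝ) L
    simpa [s] using this
  have e1 := hγ _ (hs i) _ (hs (i + 1))
  have e2 := hγ 0 ⟨le_rfl, hL0⟩ _ (hs i)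
  have e3 := hγ _ (hs i) L ⟨hL0, le_rfl⟩
  rw [h0, zero_sub, abs_neg, abs_of_nonneg (hs i).1] at e2
  rw [h1, abs_sub_comm, abs_of_nonneg (sub_nonneg.2 (hs i).2)] at e3
  refine ⟨q i, q (i + 1), hi, hi', ?_, ?_⟩
  · have := dist_triangle4 (α (q i)) (γ (s i)) (γ (s (i + 1))) (α (q (i + 1)))
    rw [dist_comm (α (q i)) (γ (s i))] at this
    linarith [hq i, hq (i + 1)]
  · have t1 := dist_triangle (α x) (γ (s i)) (α (q i))
    have t2 := dist_triangle (α (q i)) (γ (s i)) (α y)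
    rw [dist_comm (α (q i)) (γ (s i))] at t2
    linarith [hq i]

theorem IsQuasiIsometricImbedding.dist_le {α : M → N} {C₁ C₂ : ℝ}
    (h : IsQuasiIsometricImbedding α C₁ C₂) (x y : M) :
    dist x y ≤ C₁ * (dist (α x) (α y) + C₂) := by
  have h1 := (h.2.2 x y).1
  have hC : 0 < C₁ := by linarith [h.1]
  rw [one_div, sub_le_iff_le_add, inv_mul_le_iff₀ hC] at h1
  exact h1

theorem exists_coarse_additivity (hN : IsGeodesicSpace N) {α : M → N} (hα : IsQuasiIsometry α)
    (T : LinearOrder M) {K : ℝ} (hK : 0 ≤ K)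
    (h : ∀ x y z : M, T.lt x y → T.lt y z → dist x y ≤ K * dist x z) :
    ∃ E : ℝ, ∀ x y z : M, T.lt x y → T.lt y z →
      dist (α x) (α y) + dist (α y) (α z) ≤ dist (α x) (α z) + E := by
  obtain ⟨⟨C₁, C₂, hC⟩, D, hD⟩ := hα
  refine ⟨2 * D + 2 * (C₁ * (K * (C₁ * (2 * D + 1 + C₂))) + C₂), fun x y z hxy hyz => ?_⟩
  let := T
  obtain ⟨p, q, hp, hq, hpq, hsum⟩ :=
    exists_crossing hN hD (fun w => w ≤ y) (le_of_lt hxy) (not_le_of_gt hyz)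
  have hC1 : 0 ≤ C₁ := by linarith [hC.1]
  -- The crossing satisfies `p ≤ y < q`, so the triple inequality bounds the distance from `p` to
  -- `y`.
  have hpy : dist p y ≤ K * dist p q := by
    rcases lt_or_eq_of_le hp with hp | rfl
    · exact h p y q hp (not_le.1 hq)
    · rw [dist_self]; positivity
  have h1 : dist p q ≤ C₁ * (2 * D + 1 + C₂) :=
    (hC.dist_le p q).trans (mul_le_mul_of_nonneg_left (by linarith) hC1)
  have h2 : dist (α p) (α y) ≤ C₁ * (K * (C₁ * (2 * D + 1 + C₂))) + C₂ := by
    refine (hC.2.2 p y).2.trans (add_le_add_left ?_ C₂)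
    exact mul_le_mul_of_nonneg_left (hpy.trans (mul_le_mul_of_nonneg_left h1 hK)) hC1
  have t1 := dist_triangle (α x) (α p) (α y)
  have t2 := dist_triangle (α y) (α p) (α z)
  rw [dist_comm (α y) (α p)] at t2
  linarith

/-- The signed distance to a base point is a rough isometry to the real line. -/
theorem exists_rough_isometry {M : Type*} [Nonempty M] {α : M → N} (T : LinearOrder M) {E : ℝ}
    (h : ∀ x y z : M, T.lt x y → T.lt y z →
      dist (α x) (α y) + dist (α y) (α z) ≤ dist (α x) (α z) + E) :
    ∃ (f : M → ℝ) (E' : ℝ), 0 ≤ E' ∧ ∀ x y : M,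
      dist (α x) (α y) - E' ≤ dist (f x) (f y) ∧ dist (f x) (f y) ≤ dist (α x) (α y) + E' := by
  let := T
  obtain ⟨o⟩ := ‹Nonempty M›
  let f : M → ℝ := fun x => if x < o then -dist (α o) (α x) else dist (α o) (α x)
  -- `E` may be negative when `M` has no triples, hence `|E|`.
  have key : ∀ x y : M, x < y → dist (α x) (α y) - |E| ≤ f y - f x ∧
      f y - f x ≤ dist (α x) (α y) + |E| := by
    intro x y hxy
    have hE := le_abs_self E
    have hE0 := abs_nonneg E
    have t1 := dist_triangle (α o) (α x) (α y)
    have t2 := dist_triangle (α o) (α y) (α x)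
    have t3 := dist_triangle (α x) (α o) (α y)
    rw [dist_comm (α y) (α x)] at t2
    rw [dist_comm (α x) (α o)] at t3
    by_cases hy : y < o
    · have := h x y o hxy hy
      rw [dist_comm (α x) (α o), dist_comm (α y) (α o)] at this
      simp only [f, hxy.trans hy, hy, if_true]
      constructor <;> linarith
    by_cases hx : x < o
    · simp only [f, hx, hy, if_true, if_false]
      rcases lt_or_eq_of_le (not_lt.1 hy) with hy | rfl
      · have := h x o y hx hy
        rw [dist_comm (α x) (α o)] at this
        constructor <;> linarith
      · rw [dist_self, dist_comm (α x)]
        constructor <;> linarith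
    · simp only [f, hx, hy, if_false]
      rcases lt_or_eq_of_le (not_lt.1 hx) with hx | rfl
      · have := h o x y hx hxy
        constructor <;> linarith
      · rw [dist_self]
        constructor <;> linarith
  refine ⟨f, 2 * |E|, by positivity, fun x y => ?_⟩
  have hE0 := abs_nonneg E
  have aux : ∀ x y : M, x < y → dist (α x) (α y) - 2 * |E| ≤ dist (f x) (f y) ∧
      dist (f x) (f y) ≤ dist (α x) (α y) + 2 * |E| := by
    intro x y hxy
    obtain ⟨h1, h2⟩ := key x y hxy
    rw [Real.dist_eq, abs_sub_comm]
    have hd := dist_nonneg (x := α x) (y := α y)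
    exact ⟨by linarith [le_abs_self (f y - f x)], abs_le.2 ⟨by linarith, by linarith⟩⟩
  rcases lt_trichotomy x y with hxy | rfl | hxy
  · exact aux x y hxy
  · simp
  · rw [dist_comm (α x), dist_comm (f x)]
    exact aux y x hxy

theorem quasiIsometricToRay_of_bddBelow [Nonempty M] {f : M → ℝ} {C₁ C₂ D : ℝ}
    (hf : IsQuasiIsometricImbedding f C₁ C₂)
    (hD : ∀ (t : ℝ) (x y : M), f x ≤ t → t ≤ f y → ∃ p, |t - f p| ≤ D)
    (hb : BddBelow (Set.range f)) (ha : ¬ BddAbove (Set.range f)) : QuasiIsometricToRay M := by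
  obtain ⟨m, hm⟩ := hb
  have hm : ∀ x, m ≤ f x := fun x => hm ⟨x, rfl⟩
  let g : M → ℝ≥0 := fun x => ⟨f x - m, sub_nonneg.2 (hm x)⟩
  have hg : ∀ x y, dist (g x) (g y) = dist (f x) (f y) := by
    intro x y
    rw [NNReal.dist_eq, Real.dist_eq]
    change |f x - m - (f y - m)| = _
    congr 1; ring
  obtain ⟨o⟩ := ‹Nonempty M›
  refine ⟨g, ⟨C₁, C₂, hf.1, hf.2.1, fun x y => by rw [hg]; exact hf.2.2 x y⟩,
    -- Density is known only between values of `f`; points of the ray below `f o - m` are covered by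
    -- `o` itself.
    max D (f o - m), fun t => ?_⟩
  have hgd : ∀ p, dist t (g p) = |m + (t : ℝ) - f p| := by
    intro p
    rw [NNReal.dist_eq]
    change |(t : ℝ) - (f p - m)| = _
    congr 1; ring
  simp only [hgd]
  rcases le_total (f o) (m + t) with h | h
  · obtain ⟨_, ⟨y, rfl⟩, hy⟩ := not_bddAbove_iff.1 ha (m + t)
    obtain ⟨p, hp⟩ := hD _ o y h hy.le
    exact ⟨p, hp.trans (le_max_left _ _)⟩
  · refine ⟨o, le_trans ?_ (le_max_right _ _)⟩
    rw [abs_sub_comm, abs_of_nonneg (sub_nonneg.2 h)]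
    linarith [t.2]

theorem quasiIsometricToLine_of_unbounded {f : M → ℝ} {C₁ C₂ D : ℝ}
    (hf : IsQuasiIsometricImbedding f C₁ C₂)
    (hD : ∀ (t : ℝ) (x y : M), f x ≤ t → t ≤ f y → ∃ p, |t - f p| ≤ D)
    (hb : ¬ BddBelow (Set.range f)) (ha : ¬ BddAbove (Set.range f)) :
    QuasiIsometricToLine M := by
  refine ⟨f, ⟨C₁, C₂, hf⟩, D, fun t => ?_⟩
  obtain ⟨_, ⟨x, rfl⟩, hx⟩ := not_bddBelow_iff.1 hb t
  obtain ⟨_, ⟨y, rfl⟩, hy⟩ := not_bddAbove_iff.1 ha t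
  exact hD t x y hx.le hy.le

theorem quasiIsometricToPoint_of_bounded [Nonempty M] {f : M → ℝ} {C₁ C₂ : ℝ}
    (hf : IsQuasiIsometricImbedding f C₁ C₂)
    (hb : BddBelow (Set.range f)) (ha : BddAbove (Set.range f)) :
    QuasiIsometricToPoint M := by
  obtain ⟨m, hm⟩ := hb
  obtain ⟨m', hm'⟩ := ha
  have hm : ∀ x, m ≤ f x := fun x => hm ⟨x, rfl⟩
  have hm' : ∀ x, f x ≤ m' := fun x => hm' ⟨x, rfl⟩
  have hd : ∀ x y : M, dist x y ≤ C₁ * (m' - m + C₂) := by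
    intro x y
    refine (hf.dist_le x y).trans (mul_le_mul_of_nonneg_left ?_ (by linarith [hf.1]))
    have : dist (f x) (f y) ≤ m' - m :=
      abs_le.2 ⟨by linarith [hm x, hm' y], by linarith [hm y, hm' x]⟩
    linarith
  obtain ⟨o⟩ := ‹Nonempty M›
  refine ⟨fun _ => PUnit.unit, ⟨1, C₁ * (m' - m + C₂), le_rfl, (dist_nonneg (x := o) (y := o)).trans (hd o o),
    fun x y => ?_⟩, 0, fun _ => ⟨o, by simp⟩⟩
  rw [dist_self, one_div, inv_one, one_mul]
  have := hd x y
  have := dist_nonneg (x := x) (y := y)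
  constructor <;> linarith

theorem point_or_ray_or_line [Nonempty M] (hN : IsGeodesicSpace N) (hMN : QuasiIsometric M N)
    (T : LinearOrder M) {K : ℝ} (hK : 0 ≤ K)
    (h : ∀ x y z : M, T.lt x y → T.lt y z → dist x y ≤ K * dist x z) :
    QuasiIsometricToPoint M ∨ QuasiIsometricToRay M ∨ QuasiIsometricToLine M := by
  obtain ⟨α, hα⟩ := hMN
  obtain ⟨E, hE⟩ := exists_coarse_additivity hN hα T hK h
  obtain ⟨f, E', hE', hf⟩ := exists_rough_isometry T hE
  obtain ⟨⟨C₁, C₂, hC1, hC2, hC⟩, D, hD⟩ := hα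
  have hqi : IsQuasiIsometricImbedding f C₁ (C₂ + E') :=
    ⟨hC1, by positivity, fun x y =>
      ⟨by linarith [(hf x y).1, (hC x y).1], by linarith [(hf x y).2, (hC x y).2]⟩⟩
  have hD0 : 0 ≤ D := by
    obtain ⟨o⟩ := ‹Nonempty M›
    exact (hD (α o)).elim fun _ h => dist_nonneg.trans h
  -- Crossing the sublevel set `{f ≤ t}` gives `f p ≤ t < f q` with `f p` and `f q` close.
  have hdense : ∀ (t : ℝ) (x y : M), f x ≤ t → t ≤ f y → ∃ p, |t - f p| ≤ 2 * D + 1 + E' := by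
    intro t x y hx hy
    by_cases hy' : f y ≤ t
    · refine ⟨y, ?_⟩
      rw [le_antisymm hy hy', sub_self, abs_zero]
      positivity
    · obtain ⟨p, q, hp, hq, hpq, -⟩ := exists_crossing hN hD (fun w => f w ≤ t) hx hy'
      refine ⟨p, ?_⟩
      have h1 := (hf p q).2
      rw [Real.dist_eq, abs_sub_comm] at h1
      have h2 := le_abs_self (f q - f p)
      have hq := not_le.1 hq
      rw [abs_of_nonneg (sub_nonneg.2 hp)]
      linarith
  by_cases hb : BddBelow (Set.range f) <;> by_cases ha : BddAbove (Set.range f)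
  · exact Or.inl (quasiIsometricToPoint_of_bounded hqi hb ha)
  · exact Or.inr (Or.inl (quasiIsometricToRay_of_bddBelow hqi hdense hb ha))
  · refine Or.inr (Or.inl (quasiIsometricToRay_of_bddBelow (f := fun x => -f x)
      (C₁ := C₁) (C₂ := C₂ + E') (D := 2 * D + 1 + E') ?_ ?_ ?_ ?_))
    · exact ⟨hqi.1, hqi.2.1, fun x y => by rw [dist_neg_neg]; exact hqi.2.2 x y⟩
    · intro t x y hx hy
      obtain ⟨p, hp⟩ := hdense (-t) y x (by linarith) (by linarith)
      exact ⟨p, by rw [← abs_neg]; convert hp using 2; ring⟩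
    · obtain ⟨m, hm⟩ := ha
      exact ⟨-m, by rintro _ ⟨x, rfl⟩; exact neg_le_neg (hm ⟨x, rfl⟩)⟩
    · rintro ⟨m, hm⟩
      exact hb ⟨-m, by rintro _ ⟨x, rfl⟩; exact neg_le.1 (hm ⟨x, rfl⟩)⟩
  · exact Or.inr (Or.inr (quasiIsometricToLine_of_unbounded hqi hdense hb ha))

theorem QuasiIsometricToPoint.isBounded (h : QuasiIsometricToPoint M) :
    Bornology.IsBounded (Set.univ : Set M) := by
  obtain ⟨α, ⟨C₁, C₂, hC⟩, -⟩ := h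
  refine Metric.isBounded_iff.2 ⟨C₁ * (0 + C₂), fun x _ y _ => ?_⟩
  simpa using hC.dist_le x y

/-- Ordering a uniformly discrete space along a quasi-isometric imbedding into the line. -/
theorem exists_order_of_imbedding (hM : UniformlyDiscrete M) {f : M → ℝ} {C₁ C₂ : ℝ}
    (hf : IsQuasiIsometricImbedding f C₁ C₂) :
    ∃ T : LinearOrder M, ∃ K : ℝ, 0 ≤ K ∧
      ∀ x y z : M, T.lt x y → T.lt y z → dist x y ≤ K * dist x z := by
  classical
  obtain ⟨δ, hδ, hM⟩ := hM
  let W : LinearOrder M := linearOrderOfSTO WellOrderingRel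
  -- `f` need not be injective; an arbitrary well-order breaks ties.
  let e : M → ℝ ×ₗ M := fun x => toLex (f x, x)
  have he : Function.Injective e := fun x y h => congrArg (fun p => (ofLex p).2) h
  obtain ⟨T, hT⟩ : ∃ T : LinearOrder M, ∀ x y, T.lt x y → f x ≤ f y := by
    refine ⟨LinearOrder.lift' e he, fun x y (h : e x < e y) => ?_⟩
    rcases Prod.Lex.toLex_lt_toLex.1 h with h | h
    exacts [h.le, h.1.le]
  have hC1 : 0 ≤ C₁ := by linarith [hf.1]
  have hC2 := hf.2.1
  -- Monotonicity of `f` gives `d(x,y) ≤ C₁(C₁ d(x,z) + 2C₂)`, and `d(x,z) ≥ δ` turns `2C₂` into a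
  -- multiple of `d(x,z)`.
  refine ⟨T, C₁ * (C₁ + 2 * C₂ / δ), by positivity, fun x y z hxy hyz => ?_⟩
  have hxz : x ≠ z := (@lt_trans M T.toPreorder x y z hxy hyz).ne
  have h1 := hT x y hxy
  have h2 := hT y z hyz
  have hd : dist (f x) (f y) ≤ dist (f x) (f z) := by
    rw [Real.dist_eq, Real.dist_eq, abs_sub_comm, abs_sub_comm (f x),
      abs_of_nonneg (by linarith), abs_of_nonneg (by linarith)]
    linarith
  have h3 := (hf.2.2 x z).2
  have h4 : C₂ * 2 ≤ 2 * C₂ / δ * dist x z := by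
    rw [div_mul_eq_mul_div, le_div_iff₀ hδ]
    nlinarith [mul_le_mul_of_nonneg_left (hM x z hxz) hC2]
  refine (hf.dist_le x y).trans ?_
  rw [mul_assoc]
  refine mul_le_mul_of_nonneg_left ?_ hC1
  linarith

theorem exists_order_of_bounded_or_ray_or_line (hM : UniformlyDiscrete M)
    (h : Bornology.IsBounded (Set.univ : Set M) ∨ QuasiIsometricToRay M ∨
      QuasiIsometricToLine M) :
    ∃ T : LinearOrder M, ∃ K : ℝ, 0 ≤ K ∧
      ∀ x y z : M, T.lt x y → T.lt y z → dist x y ≤ K * dist x z := by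
  rcases h with h | ⟨α, ⟨C₁, C₂, hC⟩, -⟩ | ⟨α, ⟨C₁, C₂, hC⟩, -⟩
  · obtain ⟨C, hC⟩ := Metric.isBounded_iff.1 h
    refine exists_order_of_imbedding hM (f := fun _ => 0) (C₁ := 1) (C₂ := |C|)
      ⟨le_rfl, abs_nonneg C, fun x y => ?_⟩
    have h1 : dist x y ≤ C := hC (Set.mem_univ x) (Set.mem_univ y)
    have h2 := dist_nonneg (x := x) (y := y)
    rw [dist_self, one_div, inv_one, one_mul]
    constructor <;> linarith [le_abs_self C]
  · exact exists_order_of_imbedding hM (f := fun x => (α x : ℝ)) hC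
  · exact exists_order_of_imbedding hM hC

theorem orderBreakpoint_eq_one [Subsingleton M] : orderBreakpoint M = 1 := by
  classical
  let : Nonempty (LinearOrder M) := ⟨linearOrderOfSTO WellOrderingRel⟩
  simp [orderBreakpoint, orderBreakpointOf, ‹Subsingleton M›]

end Coarse

end OrderRatio

theorem mainTheorem6 {M N : Type*} [MetricSpace M] [Nonempty M] [MetricSpace N]
    (hN : OrderRatio.IsGeodesicSpace N) (hMN : OrderRatio.QuasiIsometric M N) :
    (¬ OrderRatio.QuasiIsometricToPoint M → ¬ OrderRatio.QuasiIsometricToRay M →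
        ¬ OrderRatio.QuasiIsometricToLine M → 3 ≤ OrderRatio.orderBreakpoint M) ∧
      (OrderRatio.UniformlyDiscrete M →
        (OrderRatio.orderBreakpoint M ≤ 2 ↔
          Bornology.IsBounded (Set.univ : Set M) ∨ OrderRatio.QuasiIsometricToRay M ∨
            OrderRatio.QuasiIsometricToLine M)) ∧
      (Nontrivial M →
        (OrderRatio.orderBreakpoint M ≤ 2 ↔ OrderRatio.orderBreakpoint M = 2)) := by
  have classify : OrderRatio.orderBreakpoint M ≤ 2 → OrderRatio.QuasiIsometricToPoint M ∨
      OrderRatio.QuasiIsometricToRay M ∨ OrderRatio.QuasiIsometricToLine M := by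
    intro h
    rcases subsingleton_or_nontrivial M with hs | hn
    · obtain ⟨o⟩ := ‹Nonempty M›
      exact Or.inl ⟨fun _ => PUnit.unit,
        ⟨1, 0, le_rfl, le_rfl, fun x y => by simp [Subsingleton.elim x y]⟩,
        0, fun _ => ⟨o, by simp⟩⟩
    · obtain ⟨T, K, hK, hT⟩ := OrderRatio.orderBreakpoint_le_two_iff.1 h
      exact OrderRatio.point_or_ray_or_line hN hMN T hK hT
  refine ⟨fun hp hr hl => ?_, fun hM => ⟨fun h => ?_, fun h => ?_⟩, fun hn => ?_⟩
  · by_contra hlt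
    have : OrderRatio.orderBreakpoint M ≤ 2 := Order.le_of_lt_add_one (not_le.1 hlt)
    rcases classify this with h | h | h
    exacts [hp h, hr h, hl h]
  · exact (classify h).imp_left OrderRatio.QuasiIsometricToPoint.isBounded
  · rcases subsingleton_or_nontrivial M with hs | hn
    · rw [OrderRatio.orderBreakpoint_eq_one]; norm_num
    · exact OrderRatio.orderBreakpoint_le_two_iff.2
        (OrderRatio.exists_order_of_bounded_or_ray_or_line hM h)
  · exact ⟨fun h => le_antisymm h OrderRatio.two_le_orderBreakpoint, fun h => h.le⟩
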